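/- **Setting.** A one-layer transformer with $h$ heads acts on token matrices $X\in\mathbb R^{D\times n}$ (one column per token, any $n$) by $$\mathrm{Attn}(X)=X+\sum_{i=1}^h W_V^{(i)}X\,\mathrm{softmax}\big(X^\top W_K^{(i)\top}W_Q^{(i)}X\big),\qquad \mathrm{TF}(X)=\mathrm{Attn}(X)+W_2\,\mathrm{ReLU}\big(W_1\mathrm{Attn}(X)+b_1\mathbf 1^\top\big)+b_2\mathbf 1^\top,$$ with column-wise softmax and a feed-forward network of arbitrary finite width; an $m$-layer $h$-head transformer is a composition of $m$ of these. An AlgoFormer consists of three transformers $\mathrm{TF}_{\rm pre},\mathrm{TF}_{\rm loop},\mathrm{TF}_{\rm post}$; with $t$ loops it outputs $\mathrm{TF}_{\rm post}(\mathrm{TF}_{\rm loop}^{\,t}(\mathrm{TF}_{\rm pre}(X)))$. Let $\sigma$ be the leaky ReLU with slope $\alpha>0$ on the negative half-line, applied coordinate-wise. Weight matrices $W^1,\dots,W^L\in\mathbb R^{d\times d}$ and an initial point $x\in\mathbb R^d$ generate the chain $s^0=x$, $s^{j}=\sigma(W^{j}s^{j-1})$, $1\le j\le L$. Let $s_i^j$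 be the chain of the sample $x_i$ ($1\le i\le N$, $N\ge1$) and $\hat s^j$ that of $x_{\rm test}$. For $0\le\ell<L$ the prompt $P_\ell$ has the tokens $$x_1,s_1^1,\dots,s_1^L,\ \dots,\ x_N,s_N^1,\dots,s_N^L,\ x_{\rm test},\hat s^1,\dots,\hat s^\ell .$$ The columns of $P_\ell$ have dimension $3d+3+k$: a current-state block, a next-state block and a residual block of $d$ coordinates each, three indicators, and $k$ further coordinates. In $P_\ell$ the state is in the current-state block, the last $k$ coordinates hold a positional embedding $p(n)\in\mathbb R^k$ that depends only on the position $n$ of the token in the prompt, and all other entries are $0$. For $A\in\mathbb R^{d\times d}$ let $y_i=\sigma^{-1}(s_i^{\ell+1})$ and $\mathcal L_\ell(A)=\frac1{2N}\sum_{i=1}^N\|As_i^\ell-y_i\|_2^2$. Given $A_0$ and a step size $\eta>0$, let $A_{t+1}=A_t-\eta\nabla\mathcal L_\ell(A_t)$. The *filtered prompt* $Q_\ell(A)$ has in its current-state block $s_i^\ell$ at the token of $s_i^\ell$ and $\hat s^\ell$ at the last token; in its next-state block $s_i^{\ell+1}$ at the token of $s_i^{\ell+1}$; in its residual block $As_i^\ell-y_i$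 at the token of $s_i^\ell$ and $A\hat s^\ell$ at the last token; its three indicators are the $0$-$1$ indicators of the tokens of $s_1^\ell,\dots,s_N^\ell,\hat s^\ell$, of the tokens of $s_1^{\ell+1},\dots,s_N^{\ell+1}$, and of the last token; all other entries are $0$. **Theorem.** Let $d,L\ge 0$, $N\ge1$ and $\alpha>0$. There are $k$ and a positional embedding $p:\mathbb N\to\mathbb R^k$ such that for all $B\in\mathbb R$ and $A_0\in\mathbb R^{d\times d}$ there are $\eta_0>0$ and $C\in\mathbb R$ with the following property. For all $\eta>0$, $T\in\mathbb N$ and $\varepsilon>0$ there is an AlgoFormer, with $\mathrm{TF}_{\rm pre}$ a seven-layer two-head, $\mathrm{TF}_{\rm loop}$ a one-layer two-head and $\mathrm{TF}_{\rm post}$ a one-layer one-head transformer, such that for all $W^1,\dots,W^L,x_1,\dots,x_N,x_{\rm test}$ with entries of absolute value at most $B$, all $0\le\ell<L$ and all $0\le t\le T$: 1. (filtering and gradient descent) $\mathrm{TF}_{\rm loop}^{\,t}(\mathrm{TF}_{\rm pre}(P_\ell))$ differs from $Q_\ell(A_t)$ by at most $\varepsilon$ in every entry of the first $3d+3$ rows;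 2. the next-state block of the last token of $\mathrm{TF}_{\rm post}(\mathrm{TF}_{\rm loop}^{\,t}(\mathrm{TF}_{\rm pre}(P_\ell)))$ differs from $\sigma(A_t\hat s^\ell)$ by at most $\varepsilon$ in every coordinate; 3. (finding $\hat s^{\ell+1}$) if $\eta\le\eta_0$, $\hat s^\ell\in V:=\mathrm{span}\{s_1^\ell,\dots,s_N^\ell\}$, and $\kappa>0$ satisfies $\kappa\|v\|_2^2\le\frac1N\sum_i\langle s_i^\ell,v\rangle^2$ for all $v\in V$, then this block differs from the true next state $\hat s^{\ell+1}$ by at most $\varepsilon+Ce^{-\eta\kappa t}$ in every coordinate. In particular, the AlgoFormer depends neither on the weights and the data nor on $\ell$. -/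

import Mathlib

noncomputable section

namespace CoTMLP

/-! ### Transformers and the AlgoFormer

Token matrices have rows indexed by `ι` (the embedding coordinates) and one column per token. The
column type `τ` may vary: the parameters of a transformer do not depend on the number of tokens. -/

/-- The column-wise softmax of a matrix. -/
def softmax {τ : Type} [Fintype τ] (Z : Matrix τ τ ℝ) : Matrix τ τ ℝ :=
  Matrix.of fun i j => Real.exp (Z i j) / ∑ i', Real.exp (Z i' j)

/-- The ReLU activation. -/
def relu (z : ℝ) : ℝ := max z 0

/-- The parameters of a one-layer transformer with `h` heads. -/
structure Layer (ι : Type) (h : ℕ) where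
  /-- value matrices -/
  WV : Fin h → Matrix ι ι ℝ
  /-- key matrices -/
  WK : Fin h → Matrix ι ι ℝ
  /-- query matrices -/
  WQ : Fin h → Matrix ι ι ℝ
  /-- width of the shallow feed-forward network -/
  width : ℕ
  W₁ : Matrix (Fin width) ι ℝ
  b₁ : Fin width → ℝ
  W₂ : Matrix ι (Fin width) ℝ
  b₂ : ι → ℝ

namespace Layer

variable {ι : Type} [Fintype ι] {h : ℕ} {τ : Type} [Fintype τ]

/-- Full softmax attention with a residual connection. -/
def attn (l : Layer ι h) (X : Matrix ι τ ℝ) : Matrix ι τ ℝ :=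
  X + ∑ i, l.WV i * X * softmax (X.transpose * (l.WK i).transpose * l.WQ i * X)

/-- A one-layer transformer: attention, then the token-wise feed-forward ReLU network, again with a
residual connection. -/
def eval (l : Layer ι h) (X : Matrix ι τ ℝ) : Matrix ι τ ℝ :=
  l.attn X
    + l.W₂ * (l.W₁ * l.attn X + Matrix.of fun i _ => l.b₁ i).map relu
    + Matrix.of fun i _ => l.b₂ i

end Layer

/-- An `m`-layer, `h`-head transformer. -/
abbrev Transformer (ι : Type) (m h : ℕ) : Type := Fin m → Layer ι h

/-- The layers are applied one after the other, layer `0` first. -/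
def Transformer.eval {ι : Type} [Fintype ι] {h : ℕ} {τ : Type} [Fintype τ] :
    {m : ℕ} → Transformer ι m h → Matrix ι τ ℝ → Matrix ι τ ℝ
  | 0, _, X => X
  | _ + 1, f, X => Transformer.eval (fun i => f i.succ) ((f 0).eval X)

/-- An AlgoFormer whose pre-, looped and post-transformers have the given numbers of layers and
heads. -/
structure AlgoFormer (ι : Type) (mPre hPre mLoop hLoop mPost hPost : ℕ) where
  pre : Transformer ι mPre hPre
  loop : Transformer ι mLoop hLoop
  post : Transformer ι mPost hPost

namespace AlgoFormer

variable {ι : Type} [Fintype ι] {mPre hPre mLoop hLoop mPost hPost : ℕ} {τ : Type} [Fintype τ]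

/-- The token matrix after the pre-transformer and `t` iterations of the looped transformer. -/
def hidden (F : AlgoFormer ι mPre hPre mLoop hLoop mPost hPost) (t : ℕ) (X : Matrix ι τ ℝ) :
    Matrix ι τ ℝ :=
  (fun Y => F.loop.eval Y)^[t] (F.pre.eval X)

/-- The output of the AlgoFormer run with `t` iterations of the looped transformer. -/
def output (F : AlgoFormer ι mPre hPre mLoop hLoop mPost hPost) (t : ℕ) (X : Matrix ι τ ℝ) :
    Matrix ι τ ℝ :=
  F.post.eval (F.hidden t X)

end AlgoFormer

/-! ### Chain-of-thought sequences generated by leaky-ReLU MLPs -/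

/-- Leaky ReLU with slope `α` on the negative half-line. -/
def leaky (α z : ℝ) : ℝ := if 0 ≤ z then z else α * z

/-- The inverse of leaky ReLU. -/
def leakyInv (α z : ℝ) : ℝ := if 0 ≤ z then z else z / α

theorem leakyInv_leaky {α : ℝ} (hα : 0 < α) (z : ℝ) : leakyInv α (leaky α z) = z := by
  unfold leakyInv leaky
  by_cases hz : 0 ≤ z
  · simp [hz]
  · have h : ¬ 0 ≤ α * z := not_le.2 (mul_neg_of_pos_of_neg hα (not_le.1 hz))
    simp [hz, h, mul_div_cancel_left₀ z hα.ne']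

variable {d L N : ℕ}

/-- The chain `x = s⁰, s¹, …, sᴸ` of layer outputs of the `L`-layer leaky-ReLU MLP: `s^(j+1)` is leaky
ReLU applied coordinate-wise to `W j *ᵥ s^j`. -/
def chain (α : ℝ) (W : Fin L → Matrix (Fin d) (Fin d) ℝ) (x : Fin d → ℝ) :
    Fin (L + 1) → Fin d → ℝ :=
  Fin.induction (motive := fun _ => Fin d → ℝ) x fun j s a => leaky α ((W j).mulVec s a)

/-- The tokens of the prompt
`x₁, s₁¹, …, s₁ᴸ, …, x_N, s_N¹, …, s_Nᴸ, x_test, ŝ¹, …, ŝ^ℓ`: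
`Sum.inl (i, j)` is the token of `s_i^j`, and `Sum.inr j` the token of `ŝ^j` (state `0` is the
initial point). -/
abbrev Tok (N : ℕ) {L : ℕ} (l : Fin L) : Type := (Fin N × Fin (L + 1)) ⊕ Fin ((l : ℕ) + 1)

/-- The last token, that of `ŝ^ℓ`. -/
abbrev lastTok (N : ℕ) {L : ℕ} (l : Fin L) : Tok N l := Sum.inr (Fin.last (l : ℕ))

/-- The place of a token in the prompt, counted from `0`. -/
def pos {l : Fin L} : Tok N l → ℕ
  | Sum.inl (i, j) => (i : ℕ) * (L + 1) + (j : ℕ)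
  | Sum.inr j => N * (L + 1) + (j : ℕ)

/-- The chain-of-thought state carried by a token. -/
def tokState (α : ℝ) (W : Fin L → Matrix (Fin d) (Fin d) ℝ) (xs : Fin N → Fin d → ℝ)
    (xtest : Fin d → ℝ) {l : Fin L} : Tok N l → Fin d → ℝ
  | Sum.inl (i, j) => chain α W (xs i) j
  | Sum.inr j => chain α W xtest (Fin.castLE (Nat.succ_le_succ l.isLt.le) j)

/-- The coordinates of an embedded token with a designated meaning: three blocks of `d` coordinates
(current state, next state, residual) and three indicators. -/
abbrev CoreRow (d : ℕ) : Type := (Fin d ⊕ Fin d ⊕ Fin d) ⊕ Fin 3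

/-- All coordinates of an embedded token; the last `k` are for the positional embedding and for
intermediate results. -/
abbrev Row (d k : ℕ) : Type := CoreRow d ⊕ Fin k

/-- The coordinates of the current-state block. -/
abbrev CoreRow.cur (a : Fin d) : CoreRow d := Sum.inl (Sum.inl a)
/-- The coordinates of the next-state block. -/
abbrev CoreRow.next (a : Fin d) : CoreRow d := Sum.inl (Sum.inr (Sum.inl a))

/-- The input of the AlgoFormer: states (zero-padded) together with a positional embedding `p`, which
depends on nothing but the place of the token. -/
def prompt {k : ℕ} (p : ℕ → Fin k → ℝ) (α : ℝ) (W : Fin L → Matrix (Fin d) (Fin d) ℝ)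
    (xs : Fin N → Fin d → ℝ) (xtest : Fin d → ℝ) (l : Fin L) : Matrix (Row d k) (Tok N l) ℝ :=
  Matrix.of fun r c =>
    match r with
    | Sum.inl (Sum.inl (Sum.inl a)) => tokState α W xs xtest c a
    | Sum.inl _ => 0
    | Sum.inr b => p (pos c) b

/-! ### Gradient descent for multivariate regression -/

/-- The loss `(1 / 2N) ∑ᵢ ‖A uᵢ - yᵢ‖²`. -/
def loss (u y : Fin N → Fin d → ℝ) (A : Matrix (Fin d) (Fin d) ℝ) : ℝ :=
  1 / (2 * (N : ℝ)) * ∑ i, ∑ a, (A.mulVec (u i) a - y i a) ^ 2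

/-- The gradient `(1 / N) ∑ᵢ (A uᵢ - yᵢ) uᵢᵀ` of the loss. -/
def lossGrad (u y : Fin N → Fin d → ℝ) (A : Matrix (Fin d) (Fin d) ℝ) :
    Matrix (Fin d) (Fin d) ℝ :=
  Matrix.of fun a b => 1 / (N : ℝ) * ∑ i, (A.mulVec (u i) a - y i a) * u i b

/-- `lossGrad` is the gradient of `loss`: it represents all directional derivatives. -/
theorem hasDerivAt_loss (u y : Fin N → Fin d → ℝ) (A E : Matrix (Fin d) (Fin d) ℝ) :
    HasDerivAt (fun t : ℝ => loss u y (A + t • E)) (∑ a, ∑ b, lossGrad u y A a b * E a b) 0 := by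
  have key : ∀ i a, HasDerivAt
      (fun t : ℝ => ((A + t • E).mulVec (u i) a - y i a) ^ 2)
      (2 * (A.mulVec (u i) a - y i a) * E.mulVec (u i) a) 0 := by
    intro i a
    have h1 : HasDerivAt (fun t : ℝ => (A + t • E).mulVec (u i) a - y i a)
        (E.mulVec (u i) a) 0 := by
      have : (fun t : ℝ => (A + t • E).mulVec (u i) a - y i a)
          = fun t : ℝ => A.mulVec (u i) a + t * E.mulVec (u i) a - y i a := by
        funext t
        simp [Matrix.add_mulVec, Matrix.smul_mulVec]
      rw [this]
      simpa using (((hasDerivAt_id (0 : ℝ)).mul_const (E.mulVec (u i) a)).const_add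
        (A.mulVec (u i) a)).sub_const (y i a)
    simpa using h1.fun_pow 2
  have h2 := (HasDerivAt.fun_sum (u := Finset.univ) fun i _ =>
    HasDerivAt.fun_sum (u := Finset.univ) fun a _ => key i a).const_mul (1 / (2 * (N : ℝ)))
  refine h2.congr_deriv ?_
  simp only [lossGrad, Matrix.of_apply, Matrix.mulVec, dotProduct, Finset.mul_sum, Finset.sum_mul]
  rw [Finset.sum_comm]
  refine Finset.sum_congr rfl fun a _ => ?_
  rw [Finset.sum_comm]
  refine Finset.sum_congr rfl fun b _ => Finset.sum_congr rfl fun i _ => ?_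
  by_cases hN : (N : ℝ) = 0
  · simp [hN]
  · field_simp

/-- The `t`-th iterate of gradient descent on `loss u y` with step size `η` and initial guess `A₀`. -/
def gradDescent (u y : Fin N → Fin d → ℝ) (η : ℝ) (A₀ : Matrix (Fin d) (Fin d) ℝ) :
    ℕ → Matrix (Fin d) (Fin d) ℝ
  | 0 => A₀
  | t + 1 => gradDescent u y η A₀ t - η • lossGrad u y (gradDescent u y η A₀ t)

/-! ### The regression problem hidden in the prompt, and the filtered prompt -/

/-- The regressors `s_i^ℓ`. -/
def regIn (α : ℝ) (W : Fin L → Matrix (Fin d) (Fin d) ℝ) (xs : Fin N → Fin d → ℝ) (l : Fin L) :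
    Fin N → Fin d → ℝ :=
  fun i => chain α W (xs i) l.castSucc

/-- The regression targets: leaky ReLU is undone on the states `s_i^(ℓ+1)`. -/
def regOut (α : ℝ) (W : Fin L → Matrix (Fin d) (Fin d) ℝ) (xs : Fin N → Fin d → ℝ) (l : Fin L) :
    Fin N → Fin d → ℝ :=
  fun i a => leakyInv α (chain α W (xs i) l.succ a)

/-- The filtered prompt, for a current estimate `A` of the weight matrix. Only the states `s_i^ℓ`,
`s_i^(ℓ+1)` and `ŝ^ℓ` are kept; all other tokens vanish. The residual block holds
`A s_i^ℓ - y_i` at the tokens of `s_i^ℓ` and `A ŝ^ℓ` at the last token; the three indicators mark the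
tokens of `s_i^ℓ` and `ŝ^ℓ`, the tokens of `s_i^(ℓ+1)`, and the last token. -/
def filtered (α : ℝ) (W : Fin L → Matrix (Fin d) (Fin d) ℝ) (xs : Fin N → Fin d → ℝ)
    (xtest : Fin d → ℝ) (l : Fin L) (A : Matrix (Fin d) (Fin d) ℝ) :
    Matrix (CoreRow d) (Tok N l) ℝ :=
  Matrix.of fun r c =>
    match r, c with
    | Sum.inl (Sum.inl a), Sum.inl (i, j) =>
        if j = l.castSucc then chain α W (xs i) l.castSucc a else 0
    | Sum.inl (Sum.inl a), Sum.inr j =>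
        if j = Fin.last (l : ℕ) then chain α W xtest l.castSucc a else 0
    | Sum.inl (Sum.inr (Sum.inl a)), Sum.inl (i, j) =>
        if j = l.succ then chain α W (xs i) l.succ a else 0
    | Sum.inl (Sum.inr (Sum.inl _)), Sum.inr _ => 0
    | Sum.inl (Sum.inr (Sum.inr a)), Sum.inl (i, j) =>
        if j = l.castSucc then
          A.mulVec (regIn α W xs l i) a - regOut α W xs l i a
        else 0
    | Sum.inl (Sum.inr (Sum.inr a)), Sum.inr j =>
        if j = Fin.last (l : ℕ) then A.mulVec (chain α W xtest l.castSucc) a else 0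
    | Sum.inr 0, Sum.inl (_, j) => if j = l.castSucc then 1 else 0
    | Sum.inr 0, Sum.inr j => if j = Fin.last (l : ℕ) then 1 else 0
    | Sum.inr 1, Sum.inl (_, j) => if j = l.succ then 1 else 0
    | Sum.inr 1, Sum.inr _ => 0
    | Sum.inr 2, Sum.inl _ => 0
    | Sum.inr 2, Sum.inr j => if j = Fin.last (l : ℕ) then 1 else 0

end CoTMLP

end

open CoTMLP

/-!
Feed-forward networks with a residual connection are dense in the continuous maps of the token
space in the compact-open topology: superpositions of shifted ReLUs give `exp`, and the
exponentials of linear forms span an algebra to which Stone–Weierstrass applies. Attention with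
zero keys and queries averages the tokens. A run of the AlgoFormer depends continuously on its
feed-forward maps, uniformly over the compact set of data, so it suffices to find continuous token
maps that do the job exactly.

One layer copies each state to scratch coordinates reserved for its position, and uniform
attention then distributes all of them to every token. The resulting token determines `ℓ`, its own
position and all states, hence its column of the filtered prompt together with the regression
problem; by Tietze this dependence extends to a continuous map. The loop performs gradient descent
on the stored problem and the last layer applies leaky ReLU to the residual block. Since
`y_i = W s_i`, the error of the estimate after `t` steps is `(A₀ - W) (1 - η M)ᵗ` with `M` the
second moment of the `s_i`, and `1 - η M` is a contraction on their span.
-/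

noncomputable section

namespace CoTMLP

section Density

theorem continuous_relu : Continuous relu :=
  continuous_id.max continuous_const

theorem intervalIntegral_mem_of_isClosed {E : Type*} [NormedAddCommGroup E] [NormedSpace ℝ E]
    [CompleteSpace E] {V : Submodule ℝ E} (hV : IsClosed (V : Set E)) {f : ℝ → E}
    (hf : Continuous f) (hfV : ∀ s, f s ∈ V) (a b : ℝ) : ∫ s in a..b, f s ∈ V := by
  have : CompleteSpace V := hV.completeSpace_coe
  have hg : Continuous fun s => (⟨f s, hfV s⟩ : V) := hf.subtype_mk hfV
  have h := V.subtypeL.intervalIntegral_comp_comm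
    (hg.intervalIntegrable (μ := MeasureTheory.volume) a b)
  simp only [Submodule.subtypeL_apply] at h
  exact h ▸ SetLike.coe_mem _

/-- Integration by parts against `relu'' = δ₀`. -/
theorem integral_exp_mul_relu {z R : ℝ} (hz : |z| ≤ R) :
    ∫ s in -R..R, Real.exp s * relu (z - s) = Real.exp z - Real.exp (-R) * relu (z + R + 1) := by
  obtain ⟨hRz, hzR⟩ := abs_le.1 hz
  have hcont : Continuous fun s => Real.exp s * relu (z - s) :=
    Real.continuous_exp.mul (continuous_relu.comp (continuous_const.sub continuous_id))
  have below : ∫ s in -R..z, Real.exp s * relu (z - s)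
      = Real.exp z - Real.exp (-R) * (z + R + 1) := by
    have hderiv : ∀ s, HasDerivAt (fun s => Real.exp s * (z - s + 1)) (Real.exp s * (z - s)) s :=
      fun s => ((Real.hasDerivAt_exp s).mul
        (((hasDerivAt_id s).const_sub z).add_const 1)).congr_deriv (by simp only [id]; ring)
    calc ∫ s in -R..z, Real.exp s * relu (z - s)
        = ∫ s in -R..z, Real.exp s * (z - s) :=
          intervalIntegral.integral_congr fun s hs => by
            rw [Set.uIcc_of_le hRz] at hs
            simp only [relu, max_eq_left (sub_nonneg.2 hs.2)]
      _ = Real.exp z * (z - z + 1) - Real.exp (-R) * (z - -R + 1) :=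
          intervalIntegral.integral_eq_sub_of_hasDerivAt (fun s _ => hderiv s)
            (Continuous.intervalIntegrable (by fun_prop) _ _)
      _ = Real.exp z - Real.exp (-R) * (z + R + 1) := by ring
  have above : ∫ s in z..R, Real.exp s * relu (z - s) = 0 :=
    (intervalIntegral.integral_congr fun s hs => by
      rw [Set.uIcc_of_le hzR] at hs
      simp only [relu, max_eq_right (sub_nonpos.2 hs.1), mul_zero]).trans
        intervalIntegral.integral_zero
  rw [← intervalIntegral.integral_add_adjacent_intervals (hcont.intervalIntegrable _ z)
    (hcont.intervalIntegrable z _), below, above, add_zero, relu, max_eq_left (by linarith)]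

theorem exp_comp_mem_of_relu_comp_mem {K : Type*} [TopologicalSpace K] [CompactSpace K]
    {V : Submodule ℝ C(K, ℝ)} (hV : IsClosed (V : Set C(K, ℝ))) {φ : C(K, ℝ)}
    (hφ : ∀ s : ℝ, (⟨relu, continuous_relu⟩ : C(ℝ, ℝ)).comp (φ - .const K s) ∈ V) :
    (⟨Real.exp, Real.continuous_exp⟩ : C(ℝ, ℝ)).comp φ ∈ V := by
  set ρ : ℝ → C(K, ℝ) := fun s => (⟨relu, continuous_relu⟩ : C(ℝ, ℝ)).comp (φ - .const K s)
  have hcont : Continuous fun s => Real.exp s • ρ s := by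
    refine Real.continuous_exp.smul (ContinuousMap.continuous_of_continuous_uncurry _ ?_)
    exact continuous_relu.comp ((φ.continuous.comp continuous_snd).sub continuous_fst)
  have hexp : (⟨Real.exp, Real.continuous_exp⟩ : C(ℝ, ℝ)).comp φ
      = (∫ s in -‖φ‖..‖φ‖, Real.exp s • ρ s) + Real.exp (-‖φ‖) • ρ (-‖φ‖ - 1) := by
    ext x
    have happly := (ContinuousMap.evalCLM ℝ x).intervalIntegral_comp_comm
      (hcont.intervalIntegrable (μ := MeasureTheory.volume) (-‖φ‖) ‖φ‖)
    have h := integral_exp_mul_relu (φ.norm_coe_le_norm x)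
    simp only [ContinuousMap.evalCLM_apply] at happly
    simp only [ContinuousMap.add_apply, ContinuousMap.smul_apply, ← happly]
    simp only [ρ, ContinuousMap.comp_apply, ContinuousMap.coe_mk, ContinuousMap.sub_apply,
      ContinuousMap.const_apply, smul_eq_mul, h]
    ring_nf
  rw [hexp]
  exact V.add_mem (intervalIntegral_mem_of_isClosed hV hcont (fun s => V.smul_mem _ (hφ s)) _ _)
    (V.smul_mem _ (hφ _))

variable {ι : Type} [Fintype ι]

/-- The scalar functions on `K` computed by ReLU networks with one hidden layer. -/
def shallowNets (K : Set (ι → ℝ)) : Submodule ℝ C(K, ℝ) :=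
  Submodule.span ℝ (Set.range fun q : (ι → ℝ) × ℝ =>
    ⟨fun x => relu (q.1 ⬝ᵥ x.1 + q.2), continuous_relu.comp (by fun_prop)⟩)

/-- The exponentials of linear functionals on `K`, as a homomorphism; their span is an algebra. -/
def expDotProduct (K : Set (ι → ℝ)) : Multiplicative (ι → ℝ) →* C(K, ℝ) where
  toFun w := ⟨fun x => Real.exp (w.toAdd ⬝ᵥ x.1), by fun_prop⟩
  map_one' := by ext; simp
  map_mul' v w := by ext; simp [Real.exp_add, add_dotProduct]

theorem expDotProduct_mem_topologicalClosure_shallowNets {K : Set (ι → ℝ)} [CompactSpace K]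
    (w : Multiplicative (ι → ℝ)) :
    expDotProduct K w ∈ (shallowNets K).topologicalClosure :=
  exp_comp_mem_of_relu_comp_mem (shallowNets K).isClosed_topologicalClosure
    (φ := ⟨fun x => w.toAdd ⬝ᵥ x.1, by fun_prop⟩) fun s =>
      Submodule.le_topologicalClosure _ (Submodule.subset_span ⟨(w.toAdd, -s), rfl⟩)

theorem separatesPoints_adjoin_range_expDotProduct (K : Set (ι → ℝ)) :
    (Algebra.adjoin ℝ (Set.range (expDotProduct K))).SeparatesPoints := by
  classical
  intro x y hxy
  obtain ⟨i, hi⟩ := Function.ne_iff.1 (Subtype.coe_injective.ne hxy)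
  refine ⟨_, ⟨expDotProduct K (Multiplicative.ofAdd (Pi.single i 1)),
    Algebra.subset_adjoin ⟨_, rfl⟩, rfl⟩, ?_⟩
  simpa [expDotProduct] using hi

theorem topologicalClosure_shallowNets (K : Set (ι → ℝ)) [CompactSpace K] :
    (shallowNets K).topologicalClosure = ⊤ := by
  have hle : Subalgebra.toSubmodule (Algebra.adjoin ℝ (Set.range (expDotProduct K)))
      ≤ (shallowNets K).topologicalClosure := by
    rw [← MonoidHom.coe_mrange, Algebra.adjoin_eq_span, Submonoid.closure_eq, Submodule.span_le]
    rintro _ ⟨w, rfl⟩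
    exact expDotProduct_mem_topologicalClosure_shallowNets w
  refine eq_top_iff.2 fun g _ => ?_
  exact closure_minimal (s := (Algebra.adjoin ℝ (Set.range (expDotProduct K)) : Set C(K, ℝ))) hle
    (shallowNets K).isClosed_topologicalClosure
    (ContinuousMap.continuousMap_mem_subalgebra_closure_of_separatesPoints _
      (separatesPoints_adjoin_range_expDotProduct K) g)

theorem exists_shallowNet_dist_lt (g : C(ι → ℝ, ℝ)) {K : Set (ι → ℝ)} (hK : IsCompact K) {ε : ℝ}
    (hε : 0 < ε) :
    ∃ (n : ℕ) (c : Fin n → ℝ) (w : Fin n → ι → ℝ) (b : Fin n → ℝ), ∀ x ∈ K,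
      dist (∑ i, c i * relu (w i ⬝ᵥ x + b i)) (g x) < ε := by
  have : CompactSpace K := isCompact_iff_compactSpace.1 hK
  have hmem : g.restrict K ∈ closure (shallowNets K : Set C(K, ℝ)) := by
    rw [← Submodule.topologicalClosure_coe, topologicalClosure_shallowNets]
    trivial
  obtain ⟨F, hF, hdist⟩ := Metric.mem_closure_iff.1 hmem ε hε
  obtain ⟨n, c, q, rfl⟩ := Submodule.mem_span_set'.1 hF
  choose wb hwb using fun i => (q i).2
  refine ⟨n, c, fun i => (wb i).1, fun i => (wb i).2, fun x hx => ?_⟩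
  have h := (ContinuousMap.dist_lt_iff hε).1 hdist ⟨x, hx⟩
  rw [dist_comm] at h
  simpa [← hwb] using h

/-- The maps on tokens computed by a ReLU network with one hidden layer and a residual
connection. -/
def residualNets (ι : Type) [Fintype ι] : Set C(ι → ℝ, ι → ℝ) :=
  {f | ∃ (n : ℕ) (W₁ : Matrix (Fin n) ι ℝ) (b₁ : Fin n → ℝ) (W₂ : Matrix ι (Fin n) ℝ),
    ∀ x, f x = x + W₂.mulVec fun j => relu (W₁.mulVec x j + b₁ j)}

theorem exists_mem_residualNets_eq {κ : Type*} [Fintype κ] (W₁ : Matrix κ ι ℝ) (b₁ : κ → ℝ)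
    (W₂ : Matrix ι κ ℝ) :
    ∃ f ∈ residualNets ι, ∀ x, f x = x + W₂.mulVec fun j => relu (W₁.mulVec x j + b₁ j) := by
  have hcont : Continuous fun x : ι → ℝ => x + W₂.mulVec fun j => relu (W₁.mulVec x j + b₁ j) :=
    continuous_id.add (continuous_const.matrix_mulVec
      (continuous_pi fun j => continuous_relu.comp (by fun_prop)))
  let e := Fintype.equivFin κ
  refine ⟨⟨_, hcont⟩, ⟨_, W₁.submatrix e.symm id, b₁ ∘ e.symm, W₂.submatrix id e.symm,
    fun x => ?_⟩, fun _ => rfl⟩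
  rw [Matrix.submatrix_mulVec_equiv]
  simp [Function.comp_def, Matrix.mulVec, Matrix.submatrix, Matrix.of_apply]

theorem exists_residualNet_dist_lt (g : C(ι → ℝ, ι → ℝ)) {K : Set (ι → ℝ)} (hK : IsCompact K)
    {ε : ℝ} (hε : 0 < ε) : ∃ f ∈ residualNets ι, ∀ x ∈ K, dist (f x) (g x) < ε := by
  classical
  choose n c w b h using fun i =>
    exists_shallowNet_dist_lt ⟨fun x => g x i - x i, by fun_prop⟩ hK hε
  obtain ⟨f, hf, hfx⟩ := exists_mem_residualNets_eq (κ := Σ i, Fin (n i))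
    (Matrix.of fun q => w q.1 q.2) (fun q => b q.1 q.2)
    (Matrix.of fun i q => if q.1 = i then c q.1 q.2 else 0)
  have hfi : ∀ x i, f x i = x i + ∑ j, c i j * relu (w i j ⬝ᵥ x + b i j) := by
    intro x i
    rw [hfx, Pi.add_apply, Matrix.mulVec, dotProduct, Fintype.sum_sigma,
      Fintype.sum_eq_single i fun i' hi' => by simp [hi']]
    simp [Matrix.mulVec]
  refine ⟨f, hf, fun x hx => (dist_pi_lt_iff hε).2 fun i => ?_⟩
  have := h i x hx
  rwa [ContinuousMap.coe_mk, Real.dist_eq, sub_sub_eq_add_sub, add_comm, ← hfi,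
    ← Real.dist_eq] at this

theorem dense_residualNets : Dense (residualNets ι) := fun g => by
  rw [mem_closure_iff_nhds_basis
    (nhds_basis_uniformity' Metric.uniformity_basis_dist.compactConvergenceUniformity)]
  rintro ⟨K, ε⟩ ⟨hK, hε⟩
  obtain ⟨f, hf, h⟩ := exists_residualNet_dist_lt g hK hε
  exact ⟨f, hf, fun x hx => by simpa [dist_comm] using h x hx⟩

end Density

section TokenMaps

variable {ι τ : Type} {Z : Type*} [TopologicalSpace Z]

/-- The token-wise application of a map, as performed by the feed-forward part of a layer. -/
def mapTokens (f : C(ι → ℝ, ι → ℝ)) (X : Matrix ι τ ℝ) : Matrix ι τ ℝ :=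
  Matrix.of fun r c => f (X.col c) r

theorem col_iterate_mapTokens (g : C(ι → ℝ, ι → ℝ)) (X : Matrix ι τ ℝ) (c : τ) (t : ℕ) :
    ((mapTokens g)^[t] X).col c = g^[t] (X.col c) :=
  Function.Semiconj.iterate_right (f := fun Y : Matrix ι τ ℝ => Y.col c) (fun _ => rfl) t X

theorem continuous_mapTokens [Finite ι] {f : Z → C(ι → ℝ, ι → ℝ)} {X : Z → Matrix ι τ ℝ}
    (hf : Continuous f) (hX : Continuous X) : Continuous fun z => mapTokens (f z) (X z) := by
  refine continuous_matrix fun r c => (continuous_apply r).comp (hf.eval ?_)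
  exact continuous_pi fun r' => hX.matrix_elem r' c

variable [Fintype τ]

/-- The average of the tokens of a token matrix, which is what attention with zero key and query
matrices sees. -/
def mean (X : Matrix ι τ ℝ) : ι → ℝ :=
  (Fintype.card τ : ℝ)⁻¹ • ∑ c, X.col c

/-- Uniform attention with value matrix `1` and a residual connection. -/
def addMean (X : Matrix ι τ ℝ) : Matrix ι τ ℝ :=
  Matrix.of fun r c => X r c + mean X r

theorem continuous_addMean {X : Z → Matrix ι τ ℝ} (hX : Continuous X) :
    Continuous fun z => addMean (X z) := by
  refine continuous_matrix fun r c => (hX.matrix_elem r c).add ?_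
  simp only [mean, Pi.smul_apply, Finset.sum_apply, Matrix.col_apply, smul_eq_mul]
  exact continuous_const.mul (continuous_finsetSum _ fun c' _ => hX.matrix_elem r c')

/-- The hidden token matrix of an idealized AlgoFormer, whose feed-forward networks are replaced by
arbitrary continuous maps: `g₀`, uniform attention and `g₁` come before the loop, `g₂` is looped. -/
def gatherIterate (g₀ g₁ g₂ : C(ι → ℝ, ι → ℝ)) (t : ℕ) (X : Matrix ι τ ℝ) : Matrix ι τ ℝ :=
  (mapTokens g₂)^[t] (mapTokens g₁ (addMean (mapTokens g₀ X)))

theorem continuous_gatherIterate [Finite ι] {g₀ g₁ g₂ : Z → C(ι → ℝ, ι → ℝ)}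
    {X : Z → Matrix ι τ ℝ} (h₀ : Continuous g₀) (h₁ : Continuous g₁) (h₂ : Continuous g₂)
    (hX : Continuous X) (t : ℕ) :
    Continuous fun z => gatherIterate (g₀ z) (g₁ z) (g₂ z) t (X z) := by
  induction t with
  | zero => exact continuous_mapTokens h₁ (continuous_addMean (continuous_mapTokens h₀ hX))
  | succ t ih =>
    simp only [gatherIterate, Function.iterate_succ_apply'] at ih ⊢
    exact continuous_mapTokens h₂ ih

theorem softmax_zero :
    softmax (0 : Matrix τ τ ℝ) = Matrix.of fun _ _ => (Fintype.card τ : ℝ)⁻¹ := by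
  ext i j
  simp [softmax]

end TokenMaps

section Layers

variable {ι : Type} [Fintype ι]

theorem exists_layer_eval_eq {h : ℕ} {f : C(ι → ℝ, ι → ℝ)} (hf : f ∈ residualNets ι)
    (V : Fin h → Matrix ι ι ℝ) :
    ∃ l : Layer ι h, ∀ {τ : Type} [Fintype τ] (X : Matrix ι τ ℝ),
      l.eval X = mapTokens f (X + Matrix.of fun r _ => (∑ i, V i).mulVec (mean X) r) := by
  obtain ⟨n, W₁, b₁, W₂, hf⟩ := hf
  refine ⟨⟨V, 0, 0, n, W₁, b₁, W₂, 0⟩, fun {τ} _ X => ?_⟩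
  have hattn : Layer.attn (h := h) ⟨V, 0, 0, n, W₁, b₁, W₂, 0⟩ X
      = X + Matrix.of fun r (_ : τ) => (∑ i, V i).mulVec (mean X) r := by
    have hmean : X * softmax (0 : Matrix τ τ ℝ) = Matrix.of fun r _ => mean X r := by
      ext r c
      simp [softmax_zero, Matrix.mul_apply, mean, ← Finset.sum_mul, mul_comm]
    simp only [Layer.attn, Pi.zero_apply, Matrix.mul_zero, Matrix.zero_mul, Matrix.mul_assoc,
      Matrix.transpose_zero, hmean, ← Matrix.sum_mul]
    rfl
  ext r c
  rw [Layer.eval, hattn]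
  simp only [mapTokens, Matrix.of_apply, hf]
  simp [Matrix.mul_apply, Matrix.mulVec, dotProduct, Matrix.col]

theorem exists_layer_eval_eq_mapTokens {h : ℕ} {f : C(ι → ℝ, ι → ℝ)}
    (hf : f ∈ residualNets ι) :
    ∃ l : Layer ι h, ∀ {τ : Type} [Fintype τ] (X : Matrix ι τ ℝ), l.eval X = mapTokens f X := by
  obtain ⟨l, hl⟩ := exists_layer_eval_eq (h := h) hf 0
  refine ⟨l, fun X => (hl X).trans (congrArg (mapTokens f) ?_)⟩
  ext
  simp

theorem exists_layer_eval_eq_mapTokens_addMean {h : ℕ} [NeZero h] {f : C(ι → ℝ, ι → ℝ)}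
    (hf : f ∈ residualNets ι) :
    ∃ l : Layer ι h, ∀ {τ : Type} [Fintype τ] (X : Matrix ι τ ℝ),
      l.eval X = mapTokens f (addMean X) := by
  classical
  obtain ⟨l, hl⟩ := exists_layer_eval_eq hf (Pi.single (0 : Fin h) 1)
  refine ⟨l, fun X => (hl X).trans (congrArg (mapTokens f) ?_)⟩
  ext
  simp [addMean]

theorem Transformer.eval_cons {τ : Type} [Fintype τ] {m h : ℕ} (l : Layer ι h)
    (F : Transformer ι m h) (X : Matrix ι τ ℝ) :
    Transformer.eval (Fin.cons l F : Transformer ι (m + 1) h) X = F.eval (l.eval X) := rfl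

theorem id_mem_residualNets : ContinuousMap.id _ ∈ residualNets ι :=
  ⟨0, 0, 0, 0, fun x => by simp⟩

theorem exists_transformer_eval_eq_self (ι : Type) [Fintype ι] (m h : ℕ) :
    ∃ F : Transformer ι m h, ∀ {τ : Type} [Fintype τ] (X : Matrix ι τ ℝ), F.eval X = X := by
  obtain ⟨l, hl⟩ := exists_layer_eval_eq_mapTokens (h := h) (id_mem_residualNets (ι := ι))
  have heval : ∀ {τ : Type} [Fintype τ] (X : Matrix ι τ ℝ), l.eval X = X := hl
  induction m with
  | zero => exact ⟨Fin.elim0, fun X => rfl⟩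
  | succ m ih =>
    obtain ⟨F, hF⟩ := ih
    exact ⟨Fin.cons l F, fun X => by rw [Transformer.eval_cons, heval, hF]⟩

variable (mPre hPre mLoop hLoop mPost hPost : ℕ) [NeZero hPre]

theorem exists_algoFormer_eq {f₀ f₁ f₂ f₃ : C(ι → ℝ, ι → ℝ)} (h₀ : f₀ ∈ residualNets ι)
    (h₁ : f₁ ∈ residualNets ι) (h₂ : f₂ ∈ residualNets ι) (h₃ : f₃ ∈ residualNets ι) :
    ∃ F : AlgoFormer ι (mPre + 2) hPre (mLoop + 1) hLoop (mPost + 1) hPost,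
      ∀ {τ : Type} [Fintype τ] (X : Matrix ι τ ℝ) (t : ℕ),
        F.hidden t X = gatherIterate f₀ f₁ f₂ t X ∧
        F.output t X = mapTokens f₃ (gatherIterate f₀ f₁ f₂ t X) := by
  obtain ⟨l₀, hl₀⟩ := exists_layer_eval_eq_mapTokens (h := hPre) h₀
  obtain ⟨l₁, hl₁⟩ := exists_layer_eval_eq_mapTokens_addMean (h := hPre) h₁
  obtain ⟨l₂, hl₂⟩ := exists_layer_eval_eq_mapTokens (h := hLoop) h₂
  obtain ⟨l₃, hl₃⟩ := exists_layer_eval_eq_mapTokens (h := hPost) h₃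
  obtain ⟨Ipre, hIpre⟩ := exists_transformer_eval_eq_self ι mPre hPre
  obtain ⟨Iloop, hIloop⟩ := exists_transformer_eval_eq_self ι mLoop hLoop
  obtain ⟨Ipost, hIpost⟩ := exists_transformer_eval_eq_self ι mPost hPost
  refine ⟨⟨Fin.cons l₀ (Fin.cons l₁ Ipre : Transformer ι (mPre + 1) hPre), Fin.cons l₂ Iloop,
    Fin.cons l₃ Ipost⟩, fun X t => ?_⟩
  simp only [AlgoFormer.output, AlgoFormer.hidden, Transformer.eval_cons, hIpre, hIloop, hIpost,
    hl₀, hl₁, hl₂, hl₃, gatherIterate, and_self]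

theorem eventually_forall_mem_dist_lt {P Z E : Type*} [TopologicalSpace P] [TopologicalSpace Z]
    [PseudoMetricSpace E] {Φ : P × Z → E} (hΦ : Continuous Φ) {K : Set Z} (hK : IsCompact K)
    (p₀ : P) {ε : ℝ} (hε : 0 < ε) : ∀ᶠ p in nhds p₀, ∀ z ∈ K, dist (Φ (p, z)) (Φ (p₀, z)) < ε := by
  obtain ⟨v, hv, h⟩ := hK.mem_uniformity_of_prod (f := fun p z => Φ (p, z)) (s := Set.univ)
    hΦ.continuousOn (Set.mem_univ p₀) (Metric.dist_mem_uniformity hε)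
  exact Filter.mem_of_superset (nhdsWithin_univ p₀ ▸ hv) h

/-- The run of an AlgoFormer depends continuously on its feed-forward maps, so that it suffices to
approximate these in the compact-open topology. -/
theorem exists_algoFormer_near {Z Λ : Type*} [TopologicalSpace Z] [Finite Λ] {τ : Λ → Type}
    [∀ l, Fintype (τ l)] {X : ∀ l, Z → Matrix ι (τ l) ℝ} (hX : ∀ l, Continuous (X l)) {K : Set Z}
    (hK : IsCompact K)
    (g₀ g₁ g₂ g₃ : C(ι → ℝ, ι → ℝ)) (T : ℕ) {ε : ℝ} (hε : 0 < ε) :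
    ∃ F : AlgoFormer ι (mPre + 2) hPre (mLoop + 1) hLoop (mPost + 1) hPost,
      ∀ l, ∀ z ∈ K, ∀ t ≤ T, ∀ r c,
        |F.hidden t (X l z) r c - gatherIterate g₀ g₁ g₂ t (X l z) r c| ≤ ε ∧
        |F.output t (X l z) r c - mapTokens g₃ (gatherIterate g₀ g₁ g₂ t (X l z)) r c| ≤ ε := by
  let g : Fin 4 → C(ι → ℝ, ι → ℝ) := ![g₀, g₁, g₂, g₃]
  let hid (l : Λ) (t : ℕ) (q : (Fin 4 → C(ι → ℝ, ι → ℝ)) × Z) : Matrix ι (τ l) ℝ :=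
    gatherIterate (q.1 0) (q.1 1) (q.1 2) t (X l q.2)
  have hhid : ∀ l t, Continuous (hid l t) := fun l t =>
    continuous_gatherIterate (by fun_prop) (by fun_prop) (by fun_prop)
      ((hX l).comp continuous_snd) t
  have hout : ∀ l t, Continuous fun q => mapTokens (q.1 3) (hid l t q) := fun l t =>
    continuous_mapTokens (by fun_prop) (hhid l t)
  have hnear : ∀ᶠ f in nhds g, ∀ (l : Λ) (t : Fin (T + 1)) (r : ι) (c : τ l), ∀ z ∈ K,
      dist (hid l t (f, z) r c, mapTokens (f 3) (hid l t (f, z)) r c)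
        (hid l t (g, z) r c, mapTokens (g 3) (hid l t (g, z)) r c) < ε := by
    simp only [Filter.eventually_all]
    exact fun l t r c => eventually_forall_mem_dist_lt
      (((hhid l t).matrix_elem r c).prodMk ((hout l t).matrix_elem r c)) hK g hε
  obtain ⟨f, hfnet, hf⟩ :=
    (dense_pi Set.univ fun (_ : Fin 4) _ => dense_residualNets (ι := ι)).inter_nhds_nonempty hnear
  obtain ⟨F, hF⟩ := exists_algoFormer_eq mPre hPre mLoop hLoop mPost hPost
    (hfnet 0 trivial) (hfnet 1 trivial) (hfnet 2 trivial) (hfnet 3 trivial)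
  refine ⟨F, fun l z hz t ht r c => ?_⟩
  rw [(hF _ t).1, (hF _ t).2]
  have := hf l ⟨t, Nat.lt_succ_of_le ht⟩ r c z hz
  rw [Prod.dist_eq, max_lt_iff] at this
  exact ⟨this.1.le, this.2.le⟩

end Layers

section Activation

theorem leaky_eq (α z : ℝ) : leaky α z = max z 0 + α * min z 0 := by
  unfold leaky
  split_ifs with h
  · simp [h]
  · simp [(not_le.1 h).le]

theorem continuous_leaky (α : ℝ) : Continuous (leaky α) := by
  simp only [funext (leaky_eq α)]
  fun_prop

theorem abs_leaky_sub_leaky_le {α : ℝ} (hα : 0 ≤ α) (x y : ℝ) :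
    |leaky α x - leaky α y| ≤ (1 + α) * |x - y| := by
  have hmin : |min x 0 - min y 0| ≤ |x - y| := by
    simpa using abs_min_sub_min_le_max x 0 y 0
  calc |leaky α x - leaky α y|
      = |(max x 0 - max y 0) + α * (min x 0 - min y 0)| := by
        rw [leaky_eq, leaky_eq]
        ring_nf
    _ ≤ |max x 0 - max y 0| + α * |min x 0 - min y 0| := by
        rw [← abs_of_nonneg hα, ← abs_mul, abs_of_nonneg hα]
        exact abs_add_le _ _
    _ ≤ (1 + α) * |x - y| := by
        linarith [abs_max_sub_max_le_abs x y 0, mul_le_mul_of_nonneg_left hmin hα]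

theorem leakyInv_eq_leaky_inv (α z : ℝ) : leakyInv α z = leaky α⁻¹ z := by
  rw [leakyInv, leaky, inv_mul_eq_div]

end Activation

section Data

variable {d L N : ℕ}

/-- The weight matrices, the initial points of the samples and the initial test point. -/
abbrev Data (d L N : ℕ) : Type :=
  (Fin L → Matrix (Fin d) (Fin d) ℝ) × (Fin N → Fin d → ℝ) × (Fin d → ℝ)

/-- The data with entries of absolute value at most `B`. -/
def boundedData (d L N : ℕ) (B : ℝ) : Set (Data d L N) :=
  {D | (∀ j a b, |D.1 j a b| ≤ B) ∧ (∀ i a, |D.2.1 i a| ≤ B) ∧ ∀ a, |D.2.2 a| ≤ B}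

theorem isCompact_boundedData (d L N : ℕ) (B : ℝ) : IsCompact (boundedData d L N B) := by
  have hvec : IsCompact (Set.univ.pi fun _ : Fin d => Set.Icc (-B) B) :=
    isCompact_univ_pi fun _ => isCompact_Icc
  have hdata := (isCompact_univ_pi fun _ : Fin L => isCompact_univ_pi fun _ : Fin d => hvec).prod
    ((isCompact_univ_pi fun _ : Fin N => hvec).prod hvec)
  refine (congrArg IsCompact (Set.ext fun D => ?_)).mpr hdata
  simp only [boundedData, abs_le]
  exact ⟨fun h => ⟨fun j _ a _ b _ => h.1 j a b, fun i _ a _ => h.2.1 i a, fun a _ => h.2.2 a⟩,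
    fun h => ⟨fun j a b => h.1 j trivial a trivial b trivial,
      fun i a => h.2.1 i trivial a trivial, fun a => h.2.2 a trivial⟩⟩

theorem exists_pos_forall_mem_le {Z J : Type*} [TopologicalSpace Z] [Finite J] {K : Set Z}
    (hK : IsCompact K) {f : J → Z → ℝ} (hf : ∀ j, Continuous (f j)) :
    ∃ C > 0, ∀ j, ∀ z ∈ K, f j z ≤ C := by
  choose C hC using fun j => hK.exists_bound_of_continuousOn (hf j).continuousOn
  obtain ⟨M, hM⟩ := (Set.finite_range C).bddAbove
  exact ⟨max M 1, by positivity, fun j z hz => (le_abs_self _).trans <|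
    (hC j z hz).trans <| (hM ⟨j, rfl⟩).trans (le_max_left _ _)⟩

theorem chain_succ (α : ℝ) (W : Fin L → Matrix (Fin d) (Fin d) ℝ) (x : Fin d → ℝ) (j : Fin L) :
    chain α W x j.succ = fun a => leaky α ((W j).mulVec (chain α W x j.castSucc) a) := rfl

theorem continuous_chain (α : ℝ) {Z : Type*} [TopologicalSpace Z]
    {W : Z → Fin L → Matrix (Fin d) (Fin d) ℝ} {x : Z → Fin d → ℝ} (hW : Continuous W)
    (hx : Continuous x) (j : Fin (L + 1)) : Continuous fun z => chain α (W z) (x z) j := by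
  induction j using Fin.induction with
  | zero => exact hx
  | succ j ih =>
    simp only [chain_succ]
    exact continuous_pi fun a => (continuous_leaky α).comp
      ((continuous_apply a).comp (((continuous_apply j).comp hW).matrix_mulVec ih))

theorem regOut_eq_mulVec_regIn {α : ℝ} (hα : 0 < α) (W : Fin L → Matrix (Fin d) (Fin d) ℝ)
    (xs : Fin N → Fin d → ℝ) (l : Fin L) :
    regOut α W xs l = fun i => (W l).mulVec (regIn α W xs l i) := by
  ext i a
  simp only [regOut, regIn, chain_succ, leakyInv_leaky hα]

theorem continuous_tokState (α : ℝ) {l : Fin L} (c : Tok N l) :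
    Continuous fun D : Data d L N => tokState α D.1 D.2.1 D.2.2 c := by
  rcases c with ⟨i, j⟩ | j
  · exact continuous_chain α (by fun_prop) (by fun_prop) j
  · exact continuous_chain α (by fun_prop) (by fun_prop) _

end Data

section Positions

variable {L N : ℕ} {l : Fin L}

theorem pos_inl (p : Fin N × Fin (L + 1)) :
    pos (Sum.inl p : Tok N l) = (finProdFinEquiv p : ℕ) := by
  rw [finProdFinEquiv_apply_val, pos, add_comm, mul_comm]

theorem pos_injective : Function.Injective (pos : Tok N l → ℕ) := by
  rintro (p | j) (p' | j') h
  · rw [pos_inl, pos_inl] at h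
    exact congrArg _ (finProdFinEquiv.injective (Fin.ext h))
  · have := (finProdFinEquiv p).isLt
    rw [pos_inl, pos] at h
    omega
  · have := (finProdFinEquiv p').isLt
    rw [pos_inl, pos] at h
    omega
  · exact congrArg _ (Fin.ext (Nat.add_left_cancel h))

theorem pos_le_pos_lastTok (c : Tok N l) : pos c ≤ pos (lastTok N l) := by
  rcases c with p | j
  · rw [pos_inl]
    exact (finProdFinEquiv p).isLt.le.trans (Nat.le_add_right _ _)
  · exact Nat.add_le_add_left (Fin.le_last j) _

/-- The place of a token in the longest prompt. -/
def slot (c : Tok N l) : Fin ((N + 1) * (L + 1)) :=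
  ⟨pos c, (pos_le_pos_lastTok c).trans_lt <| by
    rw [add_mul, one_mul]
    exact Nat.add_lt_add_left (l.isLt.trans (Nat.lt_succ_self L)) _⟩

theorem slot_injective : Function.Injective (slot : Tok N l → _) := fun _ _ h =>
  pos_injective (congrArg Fin.val h)

theorem eq_of_range_slot_eq {l l' : Fin L}
    (h : Set.range (slot : Tok N l → _) = Set.range (slot : Tok N l' → _)) : l = l' := by
  obtain ⟨c', hc'⟩ : slot (lastTok N l) ∈ Set.range (slot : Tok N l' → _) := h ▸ ⟨_, rfl⟩
  obtain ⟨c, hc⟩ : slot (lastTok N l') ∈ Set.range (slot : Tok N l → _) := h ▸ ⟨_, rfl⟩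
  have hle : pos (lastTok N l) ≤ pos (lastTok N l') :=
    (congrArg Fin.val hc').symm.trans_le (pos_le_pos_lastTok c')
  have hge : pos (lastTok N l') ≤ pos (lastTok N l) :=
    (congrArg Fin.val hc).symm.trans_le (pos_le_pos_lastTok c)
  exact Fin.ext (Nat.add_left_cancel (hle.antisymm hge))

end Positions

/-- The scratch coordinates of a token, beyond its designated coordinates. -/
inductive Scratch (d N L : ℕ) : Type
  | place (q : Fin ((N + 1) * (L + 1)))
  | content (q : Fin ((N + 1) * (L + 1))) (a : Fin d)
  | regressor (i : Fin N) (a : Fin d)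
  | target (i : Fin N) (a : Fin d)
  | weight (a b : Fin d)
  deriving Fintype

/-- An embedded token, as seen by the feed-forward networks. -/
abbrev Token (d N L : ℕ) : Type := Row d (Fintype.card (Scratch d N L)) → ℝ

/-- The coordinates of the residual block. -/
abbrev CoreRow.res {d : ℕ} (a : Fin d) : CoreRow d := Sum.inl (Sum.inr (Sum.inr a))

namespace Token

variable {d N L : ℕ}

/-- The coordinate of a token that stores a scratch entry. -/
def scratch (s : Scratch d N L) : Row d (Fintype.card (Scratch d N L)) :=
  Sum.inr (Fintype.equivFin _ s)

/-- The token with the given designated and scratch coordinates. -/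
def mk (core : CoreRow d → ℝ) (f : Scratch d N L → ℝ) : Token d N L :=
  Sum.elim core (f ∘ (Fintype.equivFin _).symm)

@[simp] theorem mk_inl (core : CoreRow d → ℝ) (f : Scratch d N L → ℝ) (r : CoreRow d) :
    mk core f (Sum.inl r) = core r := rfl

@[simp] theorem mk_scratch (core : CoreRow d → ℝ) (f : Scratch d N L → ℝ) (s : Scratch d N L) :
    mk core f (scratch s) = f s := by
  simp [mk, scratch]

theorem continuous_mk {Z : Type*} [TopologicalSpace Z] {core : Z → CoreRow d → ℝ}
    {f : Z → Scratch d N L → ℝ} (hcore : Continuous core) (hf : Continuous f) :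
    Continuous fun z => mk (core z) (f z) := by
  refine continuous_pi fun r => ?_
  rcases r with r | b
  · exact (continuous_apply r).comp hcore
  · exact (continuous_apply ((Fintype.equivFin (Scratch d N L)).symm b)).comp hf

end Token

/-- The scratch part of the positional embedding: the `n`-th token marks its own place. -/
def placeMark (d N L n : ℕ) : Scratch d N L → ℝ
  | .place q => if (q : ℕ) = n then 1 else 0
  | _ => 0

/-- The positional embedding that makes the `n`-th token mark its own place. -/
def position (d N L n : ℕ) : Fin (Fintype.card (Scratch d N L)) → ℝ :=
  placeMark d N L n ∘ (Fintype.equivFin _).symm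

section Gathering

variable {d L N : ℕ} {l : Fin L} (α : ℝ) (D : Data d L N)

/-- The prompt generated by the given data. -/
def Data.prompt (l : Fin L) : Matrix (Row d (Fintype.card (Scratch d N L))) (Tok N l) ℝ :=
  CoTMLP.prompt (position d N L) α D.1 D.2.1 D.2.2 l

theorem Data.continuous_prompt (l : Fin L) :
    Continuous fun D : Data d L N => D.prompt α l := by
  refine continuous_matrix fun r c => ?_
  rcases r with ((a | _ | _) | _) | _
  · exact (continuous_apply a).comp (continuous_tokState α c)
  all_goals exact continuous_const

/-- The token map that copies the place mark and the state of a token to the scratch entries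
reserved for that place, and clears everything else. -/
def spread (d N L : ℕ) : C(Token d N L, Token d N L) where
  toFun x := Token.mk 0 fun
    | .place q => x (Token.scratch (.place q))
    | .content q a => x (Token.scratch (.place q)) * x (Sum.inl (CoreRow.cur a))
    | _ => 0
  continuous_toFun := by
    refine Token.continuous_mk continuous_const (continuous_pi fun s => ?_)
    cases s <;> fun_prop

/-- The token at `c` after spreading and uniform attention. -/
def Data.gathered (c : Tok N l) : Token d N L :=
  (addMean (mapTokens (spread d N L) (D.prompt α l))).col c

theorem Data.continuous_gathered (c : Tok N l) :
    Continuous fun D : Data d L N => D.gathered α c :=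
  continuous_pi fun r => (continuous_addMean
    (continuous_mapTokens continuous_const (Data.continuous_prompt α l))).matrix_elem r c

theorem Data.prompt_scratch (c : Tok N l) (s : Scratch d N L) :
    D.prompt α l (Token.scratch s) c = placeMark d N L (pos c) s := by
  simp [Data.prompt, CoTMLP.prompt, Token.scratch, position]

theorem spread_prompt_place (c : Tok N l) (q : Fin ((N + 1) * (L + 1))) :
    spread d N L ((D.prompt α l).col c) (Token.scratch (.place q))
      = if q = slot c then 1 else 0 := by
  simp only [spread, ContinuousMap.coe_mk, Token.mk_scratch, Matrix.col_apply, D.prompt_scratch,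
    placeMark, Fin.ext_iff, slot]

theorem spread_prompt_content (c : Tok N l) (q : Fin ((N + 1) * (L + 1))) (a : Fin d) :
    spread d N L ((D.prompt α l).col c) (Token.scratch (.content q a))
      = if q = slot c then tokState α D.1 D.2.1 D.2.2 c a else 0 := by
  rw [← one_mul (tokState _ _ _ _ c a), ← ite_zero_mul, ← spread_prompt_place α D c q]
  simp only [spread, ContinuousMap.coe_mk, Token.mk_scratch]
  rfl

theorem Data.gathered_apply (c : Tok N l) (r : Row d (Fintype.card (Scratch d N L))) :
    D.gathered α c r = spread d N L ((D.prompt α l).col c) r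
      + (Fintype.card (Tok N l) : ℝ)⁻¹ * ∑ c', spread d N L ((D.prompt α l).col c') r := by
  simp [Data.gathered, addMean, mean, mapTokens]

theorem Data.gathered_place_slot (c c' : Tok N l) :
    D.gathered α c (Token.scratch (.place (slot c')))
      = (if c' = c then 1 else 0) + (Fintype.card (Tok N l) : ℝ)⁻¹ := by
  simp [D.gathered_apply, spread_prompt_place, slot_injective.eq_iff]

theorem Data.gathered_place_eq_zero_iff (c : Tok N l) (q : Fin ((N + 1) * (L + 1))) :
    D.gathered α c (Token.scratch (.place q)) = 0 ↔ q ∉ Set.range (slot : Tok N l → _) := by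
  refine ⟨?_, fun hq => ?_⟩
  · rintro h ⟨c', rfl⟩
    rw [D.gathered_place_slot] at h
    have : Nonempty (Tok N l) := ⟨c⟩
    have hpos : (0 : ℝ) < (Fintype.card (Tok N l) : ℝ)⁻¹ := by positivity
    split_ifs at h <;> linarith
  · have hne : ∀ c' : Tok N l, q ≠ slot c' := fun c' h => hq ⟨c', h.symm⟩
    simp [D.gathered_apply, spread_prompt_place, hne]

theorem Data.gathered_content_slot (c c' : Tok N l) (a : Fin d) :
    D.gathered α c (Token.scratch (.content (slot c') a))
      = D.gathered α c (Token.scratch (.place (slot c'))) * tokState α D.1 D.2.1 D.2.2 c' a := by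
  rw [D.gathered_place_slot, add_mul, D.gathered_apply]
  simp only [spread_prompt_content, slot_injective.eq_iff, Finset.sum_ite_eq, Finset.mem_univ,
    if_true, ite_mul, one_mul, zero_mul]
  split_ifs with h <;> simp [h]

theorem sigma_eq_of_gathered_eq {D D' : Data d L N} {p p' : Σ l : Fin L, Tok N l}
    (h : D.gathered α p.2 = D'.gathered α p'.2) : p = p' := by
  obtain ⟨l, c⟩ := p
  obtain ⟨l', c'⟩ := p'
  obtain rfl : l = l' := eq_of_range_slot_eq <| Set.ext fun q => not_iff_not.1 <| by
    rw [← D.gathered_place_eq_zero_iff α c, ← D'.gathered_place_eq_zero_iff α c']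
    exact iff_of_eq (congrArg (· = 0) (congrFun h _))
  have hc := congrFun h (Token.scratch (.place (slot c)))
  rw [D.gathered_place_slot, D'.gathered_place_slot] at hc
  by_cases hcc : c = c'
  · rw [hcc]
  · simp [hcc] at hc

theorem tokState_eq_of_gathered_eq {D D' : Data d L N} {c : Tok N l}
    (h : D.gathered α c = D'.gathered α c) :
    (tokState α D.1 D.2.1 D.2.2 : Tok N l → _) = tokState α D'.1 D'.2.1 D'.2.2 := by
  ext c' a
  have hne : D.gathered α c (Token.scratch (.place (slot c'))) ≠ 0 := fun h0 =>
    (D.gathered_place_eq_zero_iff α c _).1 h0 ⟨c', rfl⟩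
  refine mul_left_cancel₀ hne ?_
  rw [← D.gathered_content_slot, h, D'.gathered_content_slot]

end Gathering

theorem exists_continuousMap_comp_eq {Z X J : Type*} {κ : Type*} [Finite κ] [TopologicalSpace Z]
    [TopologicalSpace X] [T2Space X] [NormalSpace X] [Finite J] {K : Set Z} (hK : IsCompact K)
    {φ : J → Z → X} (hφ : ∀ j, Continuous (φ j)) {ψ : J → Z → κ → ℝ}
    (hψ : ∀ j, Continuous (ψ j))
    (h : ∀ j j', ∀ z ∈ K, ∀ z' ∈ K, φ j z = φ j' z' → ψ j z = ψ j' z') :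
    ∃ g : C(X, κ → ℝ), ∀ j, ∀ z ∈ K, g (φ j z) = ψ j z := by
  have : CompactSpace K := isCompact_iff_compactSpace.1 hK
  let Φ : (Σ _ : J, K) → X := fun p => φ p.1 p.2
  let Ψ : C(Σ _ : J, K, κ → ℝ) :=
    ⟨fun p => ψ p.1 p.2, continuous_sigma fun j => (hψ j).comp continuous_subtype_val⟩
  have hΦ : Continuous Φ := continuous_sigma fun j => (hφ j).comp continuous_subtype_val
  have hquot : Topology.IsQuotientMap (⟨Set.rangeFactorization Φ, hΦ.subtype_mk _⟩ :
      C(Σ _ : J, K, Set.range Φ)) :=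
    (hΦ.subtype_mk _).isClosedMap.isQuotientMap (hΦ.subtype_mk _) Set.rangeFactorization_surjective
  have hfactor : Function.FactorsThrough Ψ (Set.rangeFactorization Φ) := fun p p' hp =>
    h p.1 p'.1 p.2 p.2.2 p'.2 p'.2.2 (congrArg Subtype.val hp)
  obtain ⟨g, hg⟩ := ContinuousMap.exists_restrict_eq (isCompact_range hΦ).isClosed
    (hquot.lift Ψ hfactor)
  refine ⟨g, fun j z hz => ?_⟩
  calc g (φ j z) = hquot.lift Ψ hfactor (Set.rangeFactorization Φ ⟨j, z, hz⟩) :=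
        DFunLike.congr_fun hg (Set.rangeFactorization Φ ⟨j, z, hz⟩)
    _ = ψ j z := DFunLike.congr_fun (hquot.lift_comp Ψ hfactor) ⟨j, z, hz⟩

section Filtering

variable {d L N : ℕ} {l : Fin L} (α : ℝ) (D : Data d L N)

/-- The scratch entries of a token that stores a regression problem and an estimate `A`. -/
def regressionScratch (L : ℕ) (u y : Fin N → Fin d → ℝ) (A : Matrix (Fin d) (Fin d) ℝ) :
    Scratch d N L → ℝ
  | .regressor i a => u i a
  | .target i a => y i a
  | .weight a b => A a b
  | _ => 0

/-- The column of the filtered prompt at `c`, with the regression problem and the estimate `A`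
stored in the scratch entries. -/
def Data.filteredToken (A : Matrix (Fin d) (Fin d) ℝ) (c : Tok N l) : Token d N L :=
  Token.mk (fun r => filtered α D.1 D.2.1 D.2.2 l A r c)
    (regressionScratch L (regIn α D.1 D.2.1 l) (regOut α D.1 D.2.1 l) A)

theorem continuous_regIn (l : Fin L) :
    Continuous fun D : Data d L N => regIn α D.1 D.2.1 l :=
  continuous_pi fun i => continuous_chain α (by fun_prop) (by fun_prop) _

theorem continuous_regOut (l : Fin L) :
    Continuous fun D : Data d L N => regOut α D.1 D.2.1 l := by
  refine continuous_pi fun i => continuous_pi fun a => ?_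
  simp only [regOut, leakyInv_eq_leaky_inv]
  exact (continuous_leaky _).comp ((continuous_apply a).comp
    (continuous_chain α (by fun_prop) (by fun_prop) l.succ))

theorem continuous_filtered_apply (A : Matrix (Fin d) (Fin d) ℝ) (r : CoreRow d) (c : Tok N l) :
    Continuous fun D : Data d L N => filtered α D.1 D.2.1 D.2.2 l A r c := by
  have hchain : ∀ i j a, Continuous fun D : Data d L N => chain α D.1 (D.2.1 i) j a :=
    fun i j a => (continuous_apply a).comp (continuous_chain α (by fun_prop) (by fun_prop) j)
  have htest : Continuous fun D : Data d L N => chain α D.1 D.2.2 l.castSucc :=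
    continuous_chain α (by fun_prop) (by fun_prop) _
  have hin := continuous_regIn (N := N) (d := d) α l
  have hout := continuous_regOut (N := N) (d := d) α l
  rcases r with (a | a | a) | q <;> rcases c with ⟨i, j⟩ | j
  case inr.inl | inr.inr =>
    fin_cases q <;> exact continuous_const
  all_goals
    simp only [filtered, Matrix.of_apply]
    try split_ifs
    all_goals fun_prop

theorem Data.continuous_filteredToken (A : Matrix (Fin d) (Fin d) ℝ) (c : Tok N l) :
    Continuous fun D : Data d L N => D.filteredToken α A c := by
  refine Token.continuous_mk (continuous_pi fun r => continuous_filtered_apply α A r c)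
    (continuous_pi fun s => ?_)
  have hin := continuous_regIn (N := N) (d := d) α l
  have hout := continuous_regOut (N := N) (d := d) α l
  cases s <;> simp only [regressionScratch] <;> fun_prop

theorem filteredToken_eq_of_tokState_eq {D D' : Data d L N}
    (h : (tokState α D.1 D.2.1 D.2.2 : Tok N l → _) = tokState α D'.1 D'.2.1 D'.2.2)
    (A : Matrix (Fin d) (Fin d) ℝ) (c : Tok N l) :
    D.filteredToken α A c = D'.filteredToken α A c := by
  have hchain : ∀ i j, chain α D.1 (D.2.1 i) j = chain α D'.1 (D'.2.1 i) j := fun i j =>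
    congrFun h (Sum.inl (i, j))
  have htest : chain α D.1 D.2.2 l.castSucc = chain α D'.1 D'.2.2 l.castSucc :=
    congrFun h (lastTok N l)
  have hin : regIn α D.1 D.2.1 l = regIn α D'.1 D'.2.1 l := funext fun i => hchain i _
  have hout : regOut α D.1 D.2.1 l = regOut α D'.1 D'.2.1 l := by
    simp only [funext_iff, regOut, hchain, implies_true]
  simp only [Data.filteredToken, filtered, hchain, htest, hin, hout]

theorem exists_collect {B : ℝ} (A : Matrix (Fin d) (Fin d) ℝ) :
    ∃ g : C(Token d N L, Token d N L), ∀ D ∈ boundedData d L N B, ∀ (l : Fin L) (c : Tok N l),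
      g (D.gathered α c) = D.filteredToken α A c := by
  obtain ⟨g, hg⟩ := exists_continuousMap_comp_eq (J := Σ l : Fin L, Tok N l)
    (isCompact_boundedData d L N B) (fun p => Data.continuous_gathered α p.2)
    (fun p => Data.continuous_filteredToken α A p.2) fun p p' D _ D' _ h => by
      obtain rfl := sigma_eq_of_gathered_eq α h
      exact filteredToken_eq_of_tokState_eq α (tokState_eq_of_gathered_eq α h) A p.2
  exact ⟨g, fun D hD l c => hg ⟨l, c⟩ D hD⟩

/-- The token map that performs a step of gradient descent with step size `η` on the stored
estimate and updates the residual block accordingly. -/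
def gradStep (d N L : ℕ) (η : ℝ) : C(Token d N L, Token d N L) where
  toFun x :=
    let G := lossGrad (fun i a => x (Token.scratch (.regressor i a)))
      (fun i a => x (Token.scratch (.target i a)))
      (Matrix.of fun a b => x (Token.scratch (.weight a b)))
    Token.mk
      (fun
        | Sum.inl (Sum.inr (Sum.inr a)) => x (Sum.inl (CoreRow.res a))
            - η * G.mulVec (fun b => x (Sum.inl (CoreRow.cur b))) a
        | r => x (Sum.inl r))
      (fun
        | .weight a b => x (Token.scratch (.weight a b)) - η * G a b
        | s => x (Token.scratch s))
  continuous_toFun := by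
    refine Token.continuous_mk (continuous_pi fun r => ?_) (continuous_pi fun s => ?_)
    · rcases r with (a | a | a) | q <;>
        simp only [lossGrad, Matrix.mulVec, dotProduct, Matrix.of_apply] <;> fun_prop
    · cases s <;> simp only [lossGrad, Matrix.mulVec, dotProduct, Matrix.of_apply] <;> fun_prop

theorem filtered_sub_res (A E : Matrix (Fin d) (Fin d) ℝ) (a : Fin d) (c : Tok N l) :
    filtered α D.1 D.2.1 D.2.2 l (A - E) (CoreRow.res a) c
      = filtered α D.1 D.2.1 D.2.2 l A (CoreRow.res a) c
        - E.mulVec (fun b => filtered α D.1 D.2.1 D.2.2 l A (CoreRow.cur b) c) a := by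
  rcases c with ⟨i, j⟩ | j
  · simp only [filtered, Matrix.of_apply]
    split_ifs
    · simp only [Matrix.sub_mulVec, Pi.sub_apply, regIn, sub_right_comm]
    · exact (sub_eq_self.2 (congrFun E.mulVec_zero a)).symm
  · simp only [filtered, Matrix.of_apply]
    split_ifs
    · simp only [Matrix.sub_mulVec, Pi.sub_apply]
    · exact (sub_eq_self.2 (congrFun E.mulVec_zero a)).symm

theorem gradStep_filteredToken (η : ℝ) (A : Matrix (Fin d) (Fin d) ℝ) (c : Tok N l) :
    gradStep d N L η (D.filteredToken α A c)
      = D.filteredToken α (A - η • lossGrad (regIn α D.1 D.2.1 l) (regOut α D.1 D.2.1 l) A) c := by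
  simp only [gradStep, ContinuousMap.coe_mk, Data.filteredToken, Token.mk_inl, Token.mk_scratch]
  congr 1 with r
  · rcases r with (_ | _ | a) | q
    case inl.inr.inr =>
      rw [filtered_sub_res, Matrix.smul_mulVec]
      rfl
    case inr => fin_cases q <;> cases c <;> rfl
    all_goals cases c <;> rfl
  · cases r <;> rfl

theorem iterate_gradStep_filteredToken (η : ℝ) (A₀ : Matrix (Fin d) (Fin d) ℝ) (c : Tok N l)
    (t : ℕ) :
    (gradStep d N L η)^[t] (D.filteredToken α A₀ c)
      = D.filteredToken α
          (gradDescent (regIn α D.1 D.2.1 l) (regOut α D.1 D.2.1 l) η A₀ t) c := by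
  induction t with
  | zero => rfl
  | succ t ih => rw [Function.iterate_succ_apply', ih, gradStep_filteredToken, gradDescent]

/-- The token map that applies leaky ReLU to the residual block and stores the result in the
next-state block. -/
def predict (d N L : ℕ) (α : ℝ) : C(Token d N L, Token d N L) where
  toFun x := Token.mk
    (fun
      | Sum.inl (Sum.inr (Sum.inl a)) => leaky α (x (Sum.inl (CoreRow.res a)))
      | _ => 0)
    0
  continuous_toFun := by
    refine Token.continuous_mk (continuous_pi fun r => ?_) continuous_const
    rcases r with (_ | a | _) | _
    · exact continuous_const
    · exact (continuous_leaky α).comp (continuous_apply _)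
    all_goals exact continuous_const

theorem predict_filteredToken_lastTok (A : Matrix (Fin d) (Fin d) ℝ) (a : Fin d) :
    predict d N L α (D.filteredToken α A (lastTok N l)) (Sum.inl (CoreRow.next a))
      = leaky α (A.mulVec (chain α D.1 D.2.2 l.castSucc) a) := by
  simp [predict, Data.filteredToken, filtered]

theorem col_gatherIterate_prompt {g : C(Token d N L, Token d N L)}
    {A₀ : Matrix (Fin d) (Fin d) ℝ} {c : Tok N l}
    (hg : g (D.gathered α c) = D.filteredToken α A₀ c) (η : ℝ) (t : ℕ) :
    (gatherIterate (spread d N L) g (gradStep d N L η) t (D.prompt α l)).col c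
      = D.filteredToken α
          (gradDescent (regIn α D.1 D.2.1 l) (regOut α D.1 D.2.1 l) η A₀ t) c := by
  rw [gatherIterate, col_iterate_mapTokens, ← iterate_gradStep_filteredToken, ← hg]
  rfl

theorem exists_algoFormer_filtered (mPre hPre mLoop hLoop mPost hPost : ℕ) [NeZero hPre]
    (B : ℝ) (A₀ : Matrix (Fin d) (Fin d) ℝ) (η : ℝ) (T : ℕ) {ε : ℝ} (hε : 0 < ε) :
    ∃ F : AlgoFormer (Row d (Fintype.card (Scratch d N L))) (mPre + 2) hPre (mLoop + 1) hLoop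
        (mPost + 1) hPost,
      ∀ D ∈ boundedData d L N B, ∀ l : Fin L, ∀ t ≤ T,
        (∀ r c, |F.hidden t (D.prompt α l) (Sum.inl r) c
          - filtered α D.1 D.2.1 D.2.2 l
              (gradDescent (regIn α D.1 D.2.1 l) (regOut α D.1 D.2.1 l) η A₀ t) r c| ≤ ε) ∧
        ∀ a, |F.output t (D.prompt α l) (Sum.inl (CoreRow.next a)) (lastTok N l)
          - leaky α ((gradDescent (regIn α D.1 D.2.1 l) (regOut α D.1 D.2.1 l) η A₀ t).mulVec
              (chain α D.1 D.2.2 l.castSucc) a)| ≤ ε := by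
  obtain ⟨g, hg⟩ := exists_collect (N := N) (L := L) (B := B) α A₀
  obtain ⟨F, hF⟩ := exists_algoFormer_near mPre hPre mLoop hLoop mPost hPost
    (τ := fun l : Fin L => Tok N l) (Data.continuous_prompt α) (isCompact_boundedData d L N B)
    (spread d N L) g (gradStep d N L η) (predict d N L α) T hε
  refine ⟨F, fun D hD l t ht => ⟨fun r c => ?_, fun a => ?_⟩⟩
  · have hcol := congrFun (col_gatherIterate_prompt α D (hg D hD l c) η t) (Sum.inl r)
    exact (congrArg (fun y => |F.hidden t (D.prompt α l) (Sum.inl r) c - y|) hcol).symm.trans_le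
      (hF l D hD t ht (Sum.inl r) c).1
  · rw [← predict_filteredToken_lastTok,
      ← col_gatherIterate_prompt α D (hg D hD l (lastTok N l)) η t]
    exact (hF l D hD t ht (Sum.inl (CoreRow.next a)) (lastTok N l)).2

end Filtering

section GradientDescent

theorem mulVec_dotProduct_mulVec_le_of_posSemidef {n : Type*} [Fintype n] {P : Matrix n n ℝ}
    (hP : P.PosSemidef) {S : Submodule ℝ (n → ℝ)} (hS : ∀ v ∈ S, P.mulVec v ∈ S) {c : ℝ}
    (hc : 0 < c) (hle : ∀ v ∈ S, v ⬝ᵥ P.mulVec v ≤ c * (v ⬝ᵥ v)) {v : n → ℝ} (hv : v ∈ S) :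
    P.mulVec v ⬝ᵥ P.mulVec v ≤ c ^ 2 * (v ⬝ᵥ v) := by
  set w := P.mulVec v with hw
  have hsymm : v ⬝ᵥ P.mulVec w = w ⬝ᵥ w := by
    rw [Matrix.dotProduct_mulVec, ← Matrix.mulVec_transpose,
      ← Matrix.conjTranspose_eq_transpose_of_trivial, hP.isHermitian.eq]
  have hnonneg : 0 ≤ (c • v - w) ⬝ᵥ P.mulVec (c • v - w) := by
    simpa using hP.dotProduct_mulVec_nonneg (c • v - w)
  have hexpand : (c • v - w) ⬝ᵥ P.mulVec (c • v - w)
      = c ^ 2 * (v ⬝ᵥ w) - 2 * c * (w ⬝ᵥ w) + w ⬝ᵥ P.mulVec w := by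
    simp only [Matrix.mulVec_sub, Matrix.mulVec_smul, ← hw, sub_dotProduct, dotProduct_sub,
      smul_dotProduct, dotProduct_smul, smul_eq_mul, hsymm]
    ring
  have hvw : c ^ 2 * (v ⬝ᵥ w) ≤ c ^ 2 * (c * (v ⬝ᵥ v)) :=
    mul_le_mul_of_nonneg_left (hle v hv) (sq_nonneg c)
  have hww : w ⬝ᵥ P.mulVec w ≤ c * (w ⬝ᵥ w) := hle w (hS v hv)
  refine le_of_mul_le_mul_left ?_ hc
  linarith

theorem pow_mulVec_dotProduct_self_le_of_posSemidef {n : Type*} [Fintype n] [DecidableEq n]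
    {P : Matrix n n ℝ} (hP : P.PosSemidef) {S : Submodule ℝ (n → ℝ)}
    (hS : ∀ v ∈ S, P.mulVec v ∈ S) {c : ℝ} (hc : 0 < c)
    (hle : ∀ v ∈ S, v ⬝ᵥ P.mulVec v ≤ c * (v ⬝ᵥ v)) {v : n → ℝ} (hv : v ∈ S) (t : ℕ) :
    (P ^ t).mulVec v ⬝ᵥ (P ^ t).mulVec v ≤ (c ^ t) ^ 2 * (v ⬝ᵥ v) := by
  induction t generalizing v with
  | zero => simp
  | succ t ih =>
    rw [pow_succ, ← Matrix.mulVec_mulVec]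
    calc _ ≤ (c ^ t) ^ 2 * (P.mulVec v ⬝ᵥ P.mulVec v) := ih (hS v hv)
      _ ≤ (c ^ t) ^ 2 * (c ^ 2 * (v ⬝ᵥ v)) := by
        gcongr
        exact mulVec_dotProduct_mulVec_le_of_posSemidef hP hS hc hle hv
      _ = (c ^ (t + 1)) ^ 2 * (v ⬝ᵥ v) := by ring

theorem sq_dotProduct_le {n : Type*} [Fintype n] (v w : n → ℝ) :
    (v ⬝ᵥ w) ^ 2 ≤ (v ⬝ᵥ v) * (w ⬝ᵥ w) := by
  simpa only [dotProduct, sq] using Finset.sum_mul_sq_le_sq_mul_sq Finset.univ v w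

variable {d N : ℕ} (u : Fin N → Fin d → ℝ)

/-- The empirical second moment of the regressors. -/
def secondMoment : Matrix (Fin d) (Fin d) ℝ :=
  (1 / (N : ℝ)) • ∑ i, Matrix.vecMulVec (u i) (u i)

theorem secondMoment_mulVec (v : Fin d → ℝ) :
    (secondMoment u).mulVec v = (1 / (N : ℝ)) • ∑ i, (u i ⬝ᵥ v) • u i := by
  simp [secondMoment, Matrix.smul_mulVec, Matrix.sum_mulVec, Matrix.vecMulVec_mulVec]

theorem secondMoment_mulVec_mem_span (v : Fin d → ℝ) :
    (secondMoment u).mulVec v ∈ Submodule.span ℝ (Set.range u) := by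
  rw [secondMoment_mulVec]
  exact Submodule.smul_mem _ _ <| Submodule.sum_mem _ fun i _ =>
    Submodule.smul_mem _ _ <| Submodule.subset_span ⟨i, rfl⟩

theorem dotProduct_one_sub_smul_secondMoment_mulVec (η : ℝ) (v : Fin d → ℝ) :
    v ⬝ᵥ (1 - η • secondMoment u).mulVec v
      = v ⬝ᵥ v - η * (1 / (N : ℝ) * ∑ i, (u i ⬝ᵥ v) ^ 2) := by
  simp [Matrix.sub_mulVec, Matrix.smul_mulVec, secondMoment_mulVec, sum_dotProduct,
    dotProduct_comm v, sq]

theorem posSemidef_one_sub_smul_secondMoment (hN : 0 < N) {η : ℝ} (hη : 0 ≤ η) {m : ℝ}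
    (hu : ∀ i, u i ⬝ᵥ u i ≤ m) (hm : η * m ≤ 1) : (1 - η • secondMoment u).PosSemidef := by
  have hherm : (1 - η • secondMoment u).IsHermitian := by
    simp [Matrix.IsHermitian, secondMoment, Matrix.transpose_sum, Matrix.transpose_vecMulVec]
  refine .of_dotProduct_mulVec_nonneg hherm fun v => ?_
  have hv : 0 ≤ v ⬝ᵥ v := Finset.sum_nonneg fun _ _ => mul_self_nonneg _
  have hmean : 1 / (N : ℝ) * ∑ i, (u i ⬝ᵥ v) ^ 2 ≤ m * (v ⬝ᵥ v) := by
    rw [one_div, inv_mul_le_iff₀ (Nat.cast_pos.2 hN)]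
    calc ∑ i, (u i ⬝ᵥ v) ^ 2 ≤ ∑ _ : Fin N, m * (v ⬝ᵥ v) := Finset.sum_le_sum fun i _ =>
          (sq_dotProduct_le _ _).trans (mul_le_mul_of_nonneg_right (hu i) hv)
      _ = N * (m * (v ⬝ᵥ v)) := by simp
  rw [star_trivial, dotProduct_one_sub_smul_secondMoment_mulVec, sub_nonneg]
  calc η * (1 / (N : ℝ) * ∑ i, (u i ⬝ᵥ v) ^ 2) ≤ η * (m * (v ⬝ᵥ v)) := by gcongr
    _ = η * m * (v ⬝ᵥ v) := (mul_assoc _ _ _).symm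
    _ ≤ v ⬝ᵥ v := mul_le_of_le_one_left hv hm

theorem lossGrad_eq_sub_mul_secondMoment (W A : Matrix (Fin d) (Fin d) ℝ) :
    lossGrad u (fun i => W.mulVec (u i)) A = (A - W) * secondMoment u := by
  ext a b
  simp only [lossGrad, secondMoment, Matrix.of_apply, Matrix.mul_smul, Matrix.mul_sum,
    Matrix.mul_vecMulVec, Matrix.smul_apply, Matrix.sum_apply, Matrix.vecMulVec_apply,
    Matrix.sub_mulVec, Pi.sub_apply, smul_eq_mul]

theorem gradDescent_sub_eq_mul_pow (W A₀ : Matrix (Fin d) (Fin d) ℝ) (η : ℝ) (t : ℕ) :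
    gradDescent u (fun i => W.mulVec (u i)) η A₀ t - W
      = (A₀ - W) * (1 - η • secondMoment u) ^ t := by
  induction t with
  | zero => simp [gradDescent]
  | succ t ih =>
    rw [gradDescent, lossGrad_eq_sub_mul_secondMoment, sub_right_comm, pow_succ, ← mul_assoc, ← ih,
      mul_sub, mul_one, Matrix.mul_smul]

theorem abs_gradDescent_mulVec_sub_le (hN : 0 < N) {η : ℝ} (hη : 0 ≤ η) {m : ℝ}
    (hu : ∀ i, u i ⬝ᵥ u i ≤ m) (hm : η * m ≤ 1) {κ : ℝ}
    (hκ : ∀ v ∈ Submodule.span ℝ (Set.range u),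
      κ * (v ⬝ᵥ v) ≤ 1 / (N : ℝ) * ∑ i, (u i ⬝ᵥ v) ^ 2)
    {v : Fin d → ℝ} (hv : v ∈ Submodule.span ℝ (Set.range u)) (W A₀ : Matrix (Fin d) (Fin d) ℝ)
    (t : ℕ) (a : Fin d) :
    |(gradDescent u (fun i => W.mulVec (u i)) η A₀ t).mulVec v a - W.mulVec v a|
      ≤ √((A₀ - W).row a ⬝ᵥ (A₀ - W).row a) * √(v ⬝ᵥ v) * Real.exp (-(η * κ * t)) := by
  set P := 1 - η • secondMoment u
  have hrow : 0 ≤ (A₀ - W).row a ⬝ᵥ (A₀ - W).row a := Finset.sum_nonneg fun _ _ => mul_self_nonneg _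
  have hle : ∀ w ∈ Submodule.span ℝ (Set.range u),
      w ⬝ᵥ P.mulVec w ≤ Real.exp (-(η * κ)) * (w ⬝ᵥ w) := fun w hw => by
    have hw0 : 0 ≤ w ⬝ᵥ w := Finset.sum_nonneg fun _ _ => mul_self_nonneg _
    rw [dotProduct_one_sub_smul_secondMoment_mulVec]
    calc _ ≤ w ⬝ᵥ w - η * (κ * (w ⬝ᵥ w)) :=
        sub_le_sub_left (mul_le_mul_of_nonneg_left (hκ w hw) hη) _
      _ = (-(η * κ) + 1) * (w ⬝ᵥ w) := by ring
      _ ≤ _ := by gcongr; exact Real.add_one_le_exp _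
  have hS : ∀ w ∈ Submodule.span ℝ (Set.range u), P.mulVec w ∈ Submodule.span ℝ (Set.range u) :=
    fun w hw => by
      rw [Matrix.sub_mulVec, Matrix.one_mulVec, Matrix.smul_mulVec]
      exact Submodule.sub_mem _ hw (Submodule.smul_mem _ _ (secondMoment_mulVec_mem_span u w))
  have hpow := pow_mulVec_dotProduct_self_le_of_posSemidef
    (posSemidef_one_sub_smul_secondMoment u hN hη hu hm) hS (Real.exp_pos _) hle hv t
  rw [← Real.exp_nat_mul, mul_comm (t : ℝ), neg_mul] at hpow
  rw [← Pi.sub_apply, ← Matrix.sub_mulVec, gradDescent_sub_eq_mul_pow, ← Matrix.mulVec_mulVec,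
    mul_assoc]
  calc |(A₀ - W).row a ⬝ᵥ (P ^ t).mulVec v|
      ≤ √(((A₀ - W).row a ⬝ᵥ (A₀ - W).row a) * (Real.exp (-(η * κ * t)) ^ 2 * (v ⬝ᵥ v))) :=
        Real.abs_le_sqrt ((sq_dotProduct_le _ _).trans (mul_le_mul_of_nonneg_left hpow hrow))
    _ = √((A₀ - W).row a ⬝ᵥ (A₀ - W).row a) * (√(v ⬝ᵥ v) * Real.exp (-(η * κ * t))) := by
        rw [Real.sqrt_mul hrow, Real.sqrt_mul (sq_nonneg _), Real.sqrt_sq (Real.exp_pos _).le,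
          mul_comm (Real.exp _)]

end GradientDescent

section Convergence

variable {d L N : ℕ}

theorem exists_forall_abs_leaky_gradDescent_sub_le (hN : 0 < N) {α : ℝ} (hα : 0 < α) (B : ℝ)
    (A₀ : Matrix (Fin d) (Fin d) ℝ) :
    ∃ η₀ > 0, ∃ C : ℝ, ∀ D ∈ boundedData d L N B, ∀ (l : Fin L) (η : ℝ), 0 ≤ η → η ≤ η₀ →
      chain α D.1 D.2.2 l.castSucc ∈ Submodule.span ℝ (Set.range (regIn α D.1 D.2.1 l)) →
      ∀ κ : ℝ, (∀ v ∈ Submodule.span ℝ (Set.range (regIn α D.1 D.2.1 l)),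
          κ * (v ⬝ᵥ v) ≤ 1 / (N : ℝ) * ∑ i, (regIn α D.1 D.2.1 l i ⬝ᵥ v) ^ 2) →
        ∀ (t : ℕ) (a : Fin d),
          |leaky α ((gradDescent (regIn α D.1 D.2.1 l) (regOut α D.1 D.2.1 l) η A₀ t).mulVec
              (chain α D.1 D.2.2 l.castSucc) a) - chain α D.1 D.2.2 l.succ a|
            ≤ C * Real.exp (-(η * κ * t)) := by
  have hin : ∀ l i, Continuous fun D : Data d L N => regIn α D.1 D.2.1 l i := fun l i =>
    (continuous_apply i).comp (continuous_regIn α l)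
  have htest : ∀ l : Fin L, Continuous fun D : Data d L N => chain α D.1 D.2.2 l.castSucc :=
    fun l => continuous_chain α (by fun_prop) (by fun_prop) _
  have hrow : ∀ l a, Continuous fun D : Data d L N => (A₀ - D.1 l).row a := fun l a =>
    (continuous_apply a).comp (continuous_const.sub ((continuous_apply l).comp continuous_fst))
  obtain ⟨m, hm, hregIn⟩ := exists_pos_forall_mem_le (isCompact_boundedData d L N B)
    (f := fun (p : Fin L × Fin N) D => regIn α D.1 D.2.1 p.1 p.2 ⬝ᵥ regIn α D.1 D.2.1 p.1 p.2)
    fun p => (hin p.1 p.2).dotProduct (hin p.1 p.2)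
  obtain ⟨C, -, hC⟩ := exists_pos_forall_mem_le (isCompact_boundedData d L N B)
    (f := fun (p : Fin L × Fin d) D => √((A₀ - D.1 p.1).row p.2 ⬝ᵥ (A₀ - D.1 p.1).row p.2)
      * √(chain α D.1 D.2.2 p.1.castSucc ⬝ᵥ chain α D.1 D.2.2 p.1.castSucc))
    fun p => ((hrow p.1 p.2).dotProduct (hrow p.1 p.2)).sqrt.mul
      ((htest p.1).dotProduct (htest p.1)).sqrt
  refine ⟨m⁻¹, inv_pos.2 hm, (1 + α) * C, fun D hD l η hη hηm hspan κ hκ t a => ?_⟩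
  rw [chain_succ, regOut_eq_mulVec_regIn hα]
  calc _ ≤ (1 + α) * _ := abs_leaky_sub_leaky_le hα.le _ _
    _ ≤ (1 + α) * (C * Real.exp (-(η * κ * t))) := by
      gcongr
      refine (abs_gradDescent_mulVec_sub_le _ hN hη (fun i => hregIn (l, i) D hD)
        (by rwa [← le_div_iff₀ hm, one_div]) hκ hspan _ _ t a).trans ?_
      gcongr
      exact hC (l, a) D hD
    _ = _ := (mul_assoc _ _ _).symm

end Convergence

end CoTMLP

end

theorem theorem3_general (mPre hPre mLoop hLoop mPost hPost : ℕ) [NeZero hPre] (d L N : ℕ)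
    (hN : 0 < N) (α : ℝ) (hα : 0 < α) :
    ∃ (k : ℕ) (p : ℕ → Fin k → ℝ),
      ∀ (B : ℝ) (A₀ : Matrix (Fin d) (Fin d) ℝ), ∃ η₀ > 0, ∃ C : ℝ,
        ∀ η > 0, ∀ (T : ℕ), ∀ ε > 0,
          ∃ F : AlgoFormer (Row d k) (mPre + 2) hPre (mLoop + 1) hLoop (mPost + 1) hPost,
          ∀ (W : Fin L → Matrix (Fin d) (Fin d) ℝ) (xs : Fin N → Fin d → ℝ) (xtest : Fin d → ℝ),
            (∀ j a b, |W j a b| ≤ B) → (∀ i a, |xs i a| ≤ B) → (∀ a, |xtest a| ≤ B) →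
            ∀ (l : Fin L), ∀ t ≤ T,
              (∀ r c, |F.hidden t (prompt p α W xs xtest l) (Sum.inl r) c
                - filtered α W xs xtest l
                    (gradDescent (regIn α W xs l) (regOut α W xs l) η A₀ t) r c| ≤ ε) ∧
              (∀ a, |F.output t (prompt p α W xs xtest l) (Sum.inl (CoreRow.next a)) (lastTok N l)
                - leaky α ((gradDescent (regIn α W xs l) (regOut α W xs l) η A₀ t).mulVec
                    (chain α W xtest l.castSucc) a)| ≤ ε) ∧
              (η ≤ η₀ →
                chain α W xtest l.castSucc ∈ Submodule.span ℝ (Set.range (regIn α W xs l)) →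
                ∀ κ : ℝ,
                  (∀ v ∈ Submodule.span ℝ (Set.range (regIn α W xs l)),
                    κ * (v ⬝ᵥ v) ≤ 1 / (N : ℝ) * ∑ i, (regIn α W xs l i ⬝ᵥ v) ^ 2) →
                  ∀ a, |F.output t (prompt p α W xs xtest l) (Sum.inl (CoreRow.next a))
                      (lastTok N l) - chain α W xtest l.succ a|
                    ≤ ε + C * Real.exp (-(η * κ * t))) := by
  refine ⟨Fintype.card (Scratch d N L), position d N L, fun B A₀ => ?_⟩
  obtain ⟨η₀, hη₀, C, hrate⟩ :=
    exists_forall_abs_leaky_gradDescent_sub_le (L := L) hN hα B A₀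
  refine ⟨η₀, hη₀, C, fun η hη T ε hε => ?_⟩
  obtain ⟨F, hF⟩ :=
    exists_algoFormer_filtered (N := N) (L := L) α mPre hPre mLoop hLoop mPost hPost B A₀ η T hε
  refine ⟨F, fun W xs xtest hW hxs hxtest l t ht => ?_⟩
  have hD : (W, xs, xtest) ∈ boundedData d L N B := ⟨hW, hxs, hxtest⟩
  obtain ⟨hhidden, houtput⟩ := hF _ hD l t ht
  refine ⟨hhidden, houtput, fun hη' hspan κ hκ a => ?_⟩
  exact (abs_sub_le _ _ _).trans
    (add_le_add (houtput a) (hrate _ hD l η hη.le hη' hspan κ hκ t a))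

theorem theorem3 (d L N : ℕ) (hN : 0 < N) (α : ℝ) (hα : 0 < α) :
    ∃ (k : ℕ) (p : ℕ → Fin k → ℝ),
      ∀ (B : ℝ) (A₀ : Matrix (Fin d) (Fin d) ℝ), ∃ η₀ > 0, ∃ C : ℝ,
        ∀ η > 0, ∀ (T : ℕ), ∀ ε > 0, ∃ F : AlgoFormer (Row d k) 7 2 1 2 1 1,
          ∀ (W : Fin L → Matrix (Fin d) (Fin d) ℝ) (xs : Fin N → Fin d → ℝ) (xtest : Fin d → ℝ),
            (∀ j a b, |W j a b| ≤ B) → (∀ i a, |xs i a| ≤ B) → (∀ a, |xtest a| ≤ B) →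
            ∀ (l : Fin L), ∀ t ≤ T,
              -- pre-transformer and `t` loops: filtering, then `t` steps of gradient descent
              (∀ r c, |F.hidden t (prompt p α W xs xtest l) (Sum.inl r) c
                - filtered α W xs xtest l
                    (gradDescent (regIn α W xs l) (regOut α W xs l) η A₀ t) r c| ≤ ε) ∧
              -- the output is the next state predicted by the fitted weight matrix
              (∀ a, |F.output t (prompt p α W xs xtest l) (Sum.inl (CoreRow.next a)) (lastTok N l)
                - leaky α ((gradDescent (regIn α W xs l) (regOut α W xs l) η A₀ t).mulVec
                    (chain α W xtest l.castSucc) a)| ≤ ε) ∧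
              -- and it approaches the true next state, if the samples determine it
              (η ≤ η₀ →
                chain α W xtest l.castSucc ∈ Submodule.span ℝ (Set.range (regIn α W xs l)) →
                ∀ κ > 0,
                  (∀ v ∈ Submodule.span ℝ (Set.range (regIn α W xs l)),
                    κ * (v ⬝ᵥ v) ≤ 1 / (N : ℝ) * ∑ i, (regIn α W xs l i ⬝ᵥ v) ^ 2) →
                  ∀ a, |F.output t (prompt p α W xs xtest l) (Sum.inl (CoreRow.next a))
                      (lastTok N l) - chain α W xtest l.succ a|
                    ≤ ε + C * Real.exp (-(η * κ * t))) := by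
  peel theorem3_general 5 2 0 2 0 1 d L N hN α hα
    with k p B A₀ η₀ hη₀ C η hη T ε hε F W xs xtest hW hxs hxtest l t ht h
  exact ⟨h.1, h.2.1, fun hη' hspan κ _ => h.2.2 hη' hspan κ⟩
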